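/- All graphs are finite and simple. For a graph $G$ with adjacency matrix $A(G)$, the per-spectrum of $G$ is the multiset of complex roots of the permanental polynomial $\pi(G,x)=\operatorname{per}(xI-A(G))$. It is purely imaginary if every one of these roots has real part $0$ (so $0$ counts as purely imaginary). The coalescence of two rooted graphs $(G_1,r_1)$ and $(G_2,r_2)$ is the graph obtained from their disjoint union by identifying $r_1$ with $r_2$. For integers $l,k\ge 0$, let $\mathcal R(K_{1,l}^{(k)},r_2)$ be the tree rooted at $r_2$ that is formed from $k$ disjoint copies of the star $K_{1,l}$ by joining a new vertex $r_2$ to the central vertex of each copy (for $l=0$ each copy is a single vertex; for $k=0$ the tree is the single vertex $r_2$). **Theorem.** Let $l,k\ge 0$ be integers and let $r_1$ be a vertex of degree $3$ in the complete bipartite graph $K_{2,3}$. The coalescence of $(K_{2,3},r_1)$ and $\mathcal R(K_{1,l}^{(k)},r_2)$ has purely imaginary per-spectrum if and only if one of the following holds: 1. $l\le 3$ and $l+k\ge 4$; 2. $l\ge 4$ and $k\ge 2l-4$. -/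

import Mathlib

open Polynomial

noncomputable section

namespace PerSpectrum

/-- The permanental polynomial `π(G, x) = per (x I - A(G))` of a finite simple graph, as a complex
polynomial; `Matrix.charmatrix A` is the polynomial matrix `x I - A`. -/
def permPoly {V : Type*} [Fintype V] [DecidableEq V] (G : SimpleGraph V) : ℂ[X] :=
  open Classical in (G.adjMatrix ℂ).charmatrix.permanent

/-- The per-spectrum: the multiset of complex roots of the permanental polynomial. -/
def perSpectrum {V : Type*} [Fintype V] [DecidableEq V] (G : SimpleGraph V) : Multiset ℂ :=
  (permPoly G).roots

/-- Every element of the per-spectrum is purely imaginary (zero counts as purely imaginary). -/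
def HasPurelyImaginaryPerSpectrum {V : Type*} [Fintype V] [DecidableEq V]
    (G : SimpleGraph V) : Prop :=
  ∀ z ∈ perSpectrum G, z.re = 0

/-- The vertices of the coalescence of `(G₁, r₁)` and `(G₂, r₂)`: all vertices of `G₁`, and the
vertices of `G₂` other than its root (which becomes `r₁`). -/
abbrev CoalescenceVert (V₁ : Type*) {V₂ : Type*} (r₂ : V₂) : Type _ :=
  V₁ ⊕ {v : V₂ // v ≠ r₂}

/-- The inclusion of the vertices of `G₁` in the coalescence. -/
def coalescenceLeft (V₁ : Type*) {V₂ : Type*} (r₂ : V₂) : V₁ ↪ CoalescenceVert V₁ r₂ :=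
  ⟨Sum.inl, Sum.inl_injective⟩

/-- The inclusion of the vertices of `G₂` in the coalescence: the root `r₂` is sent to `r₁`. -/
def coalescenceRight {V₁ V₂ : Type*} [DecidableEq V₂] (r₁ : V₁) (r₂ : V₂) :
    V₂ ↪ CoalescenceVert V₁ r₂ where
  toFun v := if h : v = r₂ then Sum.inl r₁ else Sum.inr ⟨v, h⟩
  inj' v w hvw := by
    by_cases hv : v = r₂ <;> by_cases hw : w = r₂ <;> simp_all

/-- The coalescence `G₁ · G₂` of the rooted graphs `(G₁, r₁)` and `(G₂, r₂)`: the union of a copy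
of `G₁` and a copy of `G₂` that share exactly the vertex `r₁ = r₂`. -/
def coalescence {V₁ V₂ : Type*} [DecidableEq V₂] (G₁ : SimpleGraph V₁) (r₁ : V₁)
    (G₂ : SimpleGraph V₂) (r₂ : V₂) : SimpleGraph (CoalescenceVert V₁ r₂) :=
  G₁.map (coalescenceLeft V₁ r₂) ⊔ G₂.map (coalescenceRight r₁ r₂)

/-- The graph `𝓡(T^(k), r)`: a new root `r = none` joined to the vertex `u` of each of `k` disjoint
copies of `T`; `some (i, v)` is the vertex `v` of the `i`-th copy. -/
def rootedJoin {W : Type*} (T : SimpleGraph W) (u : W) (k : ℕ) :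
    SimpleGraph (Option (Fin k × W)) where
  Adj
    | none, none => False
    | none, some (_, v) => v = u
    | some (_, v), none => v = u
    | some (i, v), some (j, w) => i = j ∧ T.Adj v w
  symm := ⟨by
    rintro (_ | ⟨i, v⟩) (_ | ⟨j, w⟩) h
    · exact h
    · exact h
    · exact h
    · exact ⟨h.1.symm, h.2.symm⟩⟩
  loopless := ⟨by
    rintro (_ | ⟨i, v⟩) h
    · exact h
    · exact T.irrefl h.2⟩

/-- The starlike tree `𝓡(K_{1,l}^(k), r)`, rooted at `none`: a root joined to the centres of `k`
disjoint stars `K_{1,l}`. -/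
def starlikeTree (l k : ℕ) : SimpleGraph (Option (Fin k × (Fin 1 ⊕ Fin l))) :=
  rootedJoin (completeBipartiteGraph (Fin 1) (Fin l)) (Sum.inl 0) k

end PerSpectrum

end

/-! Permanents of two blocks linked by one edge obey an edge-deletion formula, here
`permanent_fromBlocks_single`. Iterating it over the `k` stars gives, for `k ≥ 1`, the permanental
polynomial as powers of `X` and of the star's polynomial times `mainFactor l k`. The star's roots
are `0` or square roots of `-l`, so only `mainFactor` matters.

With `w = z ^ 2` the factor becomes the cubic `f(w) = (w + l)(w² + 6w + 12) + k w (w + 3)`. The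
roots `z` are purely imaginary iff all roots of `f` are real and nonpositive. Since `f > 0` for `w >
0`, the condition is real-rootedness.

Sufficiency is a sign count: `f(0) = 12l`, `f(-3) = 3(l - 3)`, `f(-4) = 4(l + k - 4)`, `f(-2) = 2(2l
- 4 - k)`. Necessity uses `f'(-3) = 3 - 3k ≤ 0`: real roots cannot all lie strictly on one side of
`-3`, yet the failing parameters force exactly that. For `k = 0` the graph is `K_{2,3}` itself, and
`w² + 6w + 12` has nonreal roots. -/

namespace Matrix

/-! ### Permanents of block matrices -/

section Permanent

open Equiv Finset

set_option linter.unusedSectionVars false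

variable {m n R : Type*} [DecidableEq m] [Fintype m] [DecidableEq n] [Fintype n] [CommRing R]

theorem permanent_submatrix_equiv (e : n ≃ m) (M : Matrix m m R) :
    (M.submatrix e e).permanent = M.permanent := by
  refine Fintype.sum_equiv e.permCongr _ _ fun σ => ?_
  refine Fintype.prod_equiv e _ _ fun i => ?_
  simp [Equiv.permCongr_apply]

theorem permanent_updateCol_add (M : Matrix n n R) (j : n) (u v : n → R) :
    permanent (updateCol M j (u + v)) =
      permanent (updateCol M j u) + permanent (updateCol M j v) := by
  simp only [permanent, ← mul_prod_erase _ _ (mem_univ j), updateCol_self, Pi.add_apply, add_mul,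
    sum_add_distrib]
  congr 1 <;>
  · refine sum_congr rfl fun σ _ => ?_
    congr 1
    refine prod_congr rfl fun i hi => ?_
    simp only [ne_eq, ne_of_mem_erase hi, not_false_eq_true, updateCol_ne]

theorem permanent_updateCol_zero (M : Matrix n n R) (j : n) :
    permanent (updateCol M j 0) = 0 := by
  simpa using permanent_updateCol_smul M j 0 0

/-- The matrix `A` with its column `r` replaced by the unit vector at `r`. Its permanent is that of
`A` with row and column `r` deleted. -/
def deleteIndex (A : Matrix n n R) (r : n) : Matrix n n R :=
  A.updateCol r (Pi.single r 1)

theorem submatrix_deleteIndex (e : n ≃ m) (A : Matrix m m R) (r : n) :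
    (A.submatrix e e).deleteIndex r = (A.deleteIndex (e r)).submatrix e e := by
  ext i j
  simp [deleteIndex, updateCol_apply, Pi.single_apply]

theorem permanent_fromBlocks_zero₂₁ (A : Matrix m m R) (B : Matrix m n R) (D : Matrix n n R) :
    (fromBlocks A B 0 D).permanent = A.permanent * D.permanent := by
  classical
  simp_rw [permanent]
  convert!
    Eq.symm <|
      sum_subset (M := R)
        (subset_univ ((Perm.sumCongrHom m n).range : Set (Perm (m ⊕ n))).toFinset) ?_
  · simp_rw [sum_mul_sum, ← sum_product', univ_product_univ]
    refine sum_nbij (fun σ ↦ σ.fst.sumCongr σ.snd) ?_ ?_ ?_ ?_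
    · intro σ₁₂ _
      simp only [Set.mem_toFinset]
      exact ⟨σ₁₂, rfl⟩
    · intro σ₁ _ σ₂ _
      dsimp only
      intro h
      have h2 : ∀ x, Perm.sumCongr σ₁.fst σ₁.snd x = Perm.sumCongr σ₂.fst σ₂.snd x :=
        DFunLike.congr_fun h
      simp only [Sum.map_inr, Sum.map_inl, Perm.sumCongr_apply, Sum.forall, Sum.inl.injEq,
        Sum.inr.injEq] at h2
      ext x
      · exact h2.left x
      · exact h2.right x
    · intro σ hσ
      rw [mem_coe, Set.mem_toFinset] at hσ
      obtain ⟨σ₁₂, hσ₁₂⟩ := hσ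
      use σ₁₂
      rw [← hσ₁₂]
      simp
    · simp only [forall_prop_of_true, Prod.forall, mem_univ]
      intro σ₁ σ₂
      rw [Fintype.prod_sum_type]
      simp_rw [Equiv.sumCongr_apply, Sum.map_inr, Sum.map_inl, fromBlocks_apply₁₁,
        fromBlocks_apply₂₂]
  · rintro σ - hσn
    have h1 : ¬∀ x, ∃ y, Sum.inl y = σ (Sum.inl x) := by
      rw [Set.mem_toFinset] at hσn
      simpa only [Set.MapsTo, Set.mem_range, forall_exists_index, forall_apply_eq_imp_iff] using
        mt Perm.mem_sumCongrHom_range_of_perm_mapsTo_inl hσn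
    obtain ⟨a, ha⟩ := not_forall.mp h1
    rcases hx : σ (Sum.inl a) with a2 | b
    · exact absurd hx.symm (not_exists.mp ha a2)
    · rw [Finset.prod_eq_zero (Finset.mem_univ (Sum.inl a))]
      rw [hx, fromBlocks_apply₂₁, zero_apply]

theorem permanent_fromBlocks_zero₁₂ (A : Matrix m m R) (C : Matrix n m R) (D : Matrix n n R) :
    (fromBlocks A 0 C D).permanent = A.permanent * D.permanent := by
  rw [← permanent_transpose, fromBlocks_transpose, transpose_zero, permanent_fromBlocks_zero₂₁,
    permanent_transpose, permanent_transpose]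

theorem permanent_succ_column_zero {n : ℕ} (A : Matrix (Fin (n + 1)) (Fin (n + 1)) R) :
    A.permanent = ∑ i, A i 0 * (A.submatrix i.succAbove Fin.succ).permanent := by
  rw [permanent, Finset.univ_perm_fin_succ, ← Finset.univ_product_univ]
  simp only [Finset.sum_map, Equiv.toEmbedding_apply, Finset.sum_product]
  refine Finset.sum_congr rfl fun i _ => Fin.cases ?_ (fun i => ?_) i
  · simp only [Fin.prod_univ_succ, permanent, Finset.mul_sum, submatrix_apply,
      Equiv.Perm.decomposeFin_symm_apply_zero, Equiv.swap_self,
      Equiv.Perm.decomposeFin_symm_apply_succ, Fin.succAbove_zero, Equiv.coe_refl, id]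
  · rw [← permanent_permute_cols i.cycleRange, permanent, Finset.mul_sum]
    refine Finset.sum_congr rfl fun σ _ => ?_
    simp [Fin.prod_univ_succ, Fin.succAbove_cycleRange,
        Equiv.Perm.decomposeFin_symm_apply_zero, Equiv.Perm.decomposeFin_symm_apply_succ]

theorem permanent_fin_three (A : Matrix (Fin 3) (Fin 3) R) :
    A.permanent = A 0 0 * (A 1 1 * A 2 2 + A 2 1 * A 1 2) +
      A 1 0 * (A 0 1 * A 2 2 + A 2 1 * A 0 2) + A 2 0 * (A 0 1 * A 1 2 + A 1 1 * A 0 2) := by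
  simp [permanent_succ_column_zero, Fin.sum_univ_succ, Fin.succAbove]
  ring

/-- The permanent of two blocks that are joined by a single pair of off-diagonal entries. -/
theorem permanent_fromBlocks_single (A : Matrix m m R) (D : Matrix n n R) (r : m) (s : n)
    (b c : R) :
    (fromBlocks A (single r s b) (single s r c) D).permanent =
      A.permanent * D.permanent + b * c * ((A.deleteIndex r).permanent *
        (D.deleteIndex s).permanent) := by
  set M := fromBlocks A (single r s b) (single s r c) D with hM
  set N := updateCol M (Sum.inl r) (Pi.single (Sum.inr s) 1) with hN
  -- A permutation uses both linking entries or neither. Splitting column `r`, then column `s`, by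
  -- linearity separates these cases; the mixed term has a zero column, and in the last one swapping
  -- the two columns gives a block diagonal matrix.
  have h₁ : M = updateCol M (Sum.inl r) (Sum.elim (fun i => A i r) (0 : n → R) +
      c • Pi.single (Sum.inr s) 1) := by
    ext (i | i) (j | j) <;>
      simp [M, updateCol_apply, single_apply, Pi.single_apply] <;> grind
  have h₂ : N = updateCol N (Sum.inr s) (Sum.elim (0 : m → R) (fun i => D i s) +
      b • Pi.single (Sum.inl r) 1) := by
    ext (i | i) (j | j) <;>
      simp [N, M, updateCol_apply, single_apply, Pi.single_apply] <;> grind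
  have h₃ : updateCol M (Sum.inl r) (Sum.elim (fun i => A i r) (0 : n → R)) =
      fromBlocks A (single r s b) 0 D := by
    ext (i | i) (j | j) <;>
      simp [M, updateCol_apply, single_apply] <;> grind
  have h₄ : updateCol N (Sum.inr s) (Sum.elim (0 : m → R) (fun i => D i s)) =
      fromBlocks (updateCol A r 0) 0 (single s r 1) D := by
    ext (i | i) (j | j) <;>
      simp [N, M, updateCol_apply, single_apply, Pi.single_apply] <;> grind
  have h₅ : (updateCol N (Sum.inr s) (Pi.single (Sum.inl r) 1)).submatrix id
      (Equiv.swap (Sum.inl r) (Sum.inr s)) =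
      fromBlocks (A.deleteIndex r) 0 0 (D.deleteIndex s) := by
    ext (i | i) (j | j)
    · by_cases hj : j = r <;>
        simp [N, M, deleteIndex, Pi.single_apply, Equiv.swap_apply_def, hj]
    · by_cases hj : j = s
      · simp [N, hj]
      · simp [N, M, Equiv.swap_apply_def, hj, Ne.symm hj]
    · by_cases hj : j = r
      · simp [N, hj]
      · simp [N, M, Equiv.swap_apply_def, hj, Ne.symm hj]
    · by_cases hj : j = s <;>
        simp [N, M, deleteIndex, Pi.single_apply, Equiv.swap_apply_def, hj]
  rw [h₁, permanent_updateCol_add, permanent_updateCol_smul, h₃, permanent_fromBlocks_zero₂₁,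
    ← hN, h₂, permanent_updateCol_add, permanent_updateCol_smul, h₄, permanent_fromBlocks_zero₁₂,
    permanent_updateCol_zero, ← permanent_permute_rows (Equiv.swap (Sum.inl r) (Sum.inr s)), h₅,
    permanent_fromBlocks_zero₁₂]
  ring

/-- The block matrix with diagonal blocks `A` and `k` copies of `D`, in which the index `r` of `A`
is linked to the index `s` of each copy of `D` by the entries `b`. -/
def attachCopies (A : Matrix m m R) (r : m) (D : Matrix n n R) (s : n) (b : R) (k : ℕ) :
    Matrix (m ⊕ Fin k × n) (m ⊕ Fin k × n) R :=
  fromBlocks A (of fun i p => if r = i ∧ s = p.2 then b else 0)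
    (of fun p i => if r = i ∧ s = p.2 then b else 0)
    (of fun p q => if p.1 = q.1 then D p.2 q.2 else 0)

/-- Split off the first of `k + 1` copies. -/
noncomputable def splitFirstCopy (m n : Type*) (k : ℕ) :
    (m ⊕ Fin k × n) ⊕ n ≃ m ⊕ Fin (k + 1) × n :=
  Equiv.ofBijective
    (Sum.elim (Sum.elim Sum.inl fun p => Sum.inr (p.1.succ, p.2)) fun t => Sum.inr (0, t)) <| by
    constructor
    · rintro ((i | ⟨j, t⟩) | t) ((i' | ⟨j', t'⟩) | t') h <;>
        simp_all [Fin.succ_ne_zero, (Fin.succ_ne_zero _).symm]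
    · rintro (i | ⟨j, t⟩)
      · exact ⟨Sum.inl (Sum.inl i), rfl⟩
      · refine Fin.cases ⟨Sum.inr t, rfl⟩ (fun j => ⟨Sum.inl (Sum.inr (j, t)), rfl⟩) j

@[simp]
theorem splitFirstCopy_inl_inl (m n : Type*) (k : ℕ) (i : m) :
    splitFirstCopy m n k (Sum.inl (Sum.inl i)) = Sum.inl i := rfl

@[simp]
theorem splitFirstCopy_inl_inr (m n : Type*) (k : ℕ) (j : Fin k) (t : n) :
    splitFirstCopy m n k (Sum.inl (Sum.inr (j, t))) = Sum.inr (j.succ, t) := rfl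

@[simp]
theorem splitFirstCopy_inr (m n : Type*) (k : ℕ) (t : n) :
    splitFirstCopy m n k (Sum.inr t) = Sum.inr (0, t) := rfl

theorem attachCopies_submatrix (A : Matrix m m R) (r : m) (D : Matrix n n R) (s : n) (b : R)
    (k : ℕ) :
    (attachCopies A r D s b (k + 1)).submatrix (splitFirstCopy m n k) (splitFirstCopy m n k) =
      fromBlocks (attachCopies A r D s b k) (single (Sum.inl r) s b) (single s (Sum.inl r) b) D := by
  ext ((i | ⟨i, t⟩) | t) ((j | ⟨j, t'⟩) | t') <;>
    simp [attachCopies, single_apply, (Fin.succ_ne_zero _).symm, and_comm]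

theorem permanent_deleteIndex_attachCopies (A : Matrix m m R) (r : m) (D : Matrix n n R) (s : n)
    (b : R) (k : ℕ) :
    ((attachCopies A r D s b k).deleteIndex (Sum.inl r)).permanent =
      (A.deleteIndex r).permanent * D.permanent ^ k := by
  induction k with
  | zero =>
    rw [← permanent_submatrix_equiv (Equiv.sumEmpty m (Fin 0 × n)).symm, pow_zero, mul_one]
    congr 1
    ext i j
    simp [deleteIndex, attachCopies, updateCol_apply, Pi.single_apply]
  | succ k ih =>
    rw [← permanent_submatrix_equiv (splitFirstCopy m n k), pow_succ, ← mul_assoc, ← ih,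
      ← permanent_fromBlocks_zero₂₁ _ (single (Sum.inl r) s b)]
    congr 1
    have hr : (splitFirstCopy m n k).symm (Sum.inl r) = Sum.inl (Sum.inl r) := by
      rw [Equiv.symm_apply_eq, splitFirstCopy_inl_inl]
    rw [deleteIndex, ← splitFirstCopy_inl_inl m n k r, submatrix_updateCol_equiv,
      splitFirstCopy_inl_inl, hr, attachCopies_submatrix]
    ext ((i | ⟨i, t⟩) | i) ((j | j) | j) <;>
      simp [updateCol_apply, deleteIndex, Pi.single_apply, single_apply, eq_comm]
    grind

/-- Each further copy is linked by a single pair of entries. The extra factor `D.permanent` on the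
left avoids the exponent `k - 1`. -/
theorem permanent_attachCopies (A : Matrix m m R) (r : m) (D : Matrix n n R) (s : n)
    (b : R) (k : ℕ) :
    D.permanent * (attachCopies A r D s b k).permanent = D.permanent ^ k *
      (D.permanent * A.permanent + k * (b * b) * ((A.deleteIndex r).permanent *
        (D.deleteIndex s).permanent)) := by
  induction k with
  | zero =>
    rw [← permanent_submatrix_equiv (Equiv.sumEmpty m (Fin 0 × n)).symm, pow_zero, one_mul]
    simp only [Nat.cast_zero, zero_mul, add_zero]
    rfl
  | succ k ih =>
    rw [← permanent_submatrix_equiv (splitFirstCopy m n k), attachCopies_submatrix,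
      permanent_fromBlocks_single, mul_add, ← mul_assoc, ih, permanent_deleteIndex_attachCopies]
    push_cast
    ring

end Permanent

end Matrix

/-! ### The permanental polynomial of the coalescence -/

namespace PerSpectrum

open Matrix

/-- The matrix `x I - A(G)`. -/
noncomputable def charMat {V : Type*} [DecidableEq V] (G : SimpleGraph V) : Matrix V V ℂ[X] :=
  open Classical in of fun i j => if i = j then X else if G.Adj i j then -1 else 0

theorem permPoly_eq {V : Type*} [Fintype V] [DecidableEq V] (G : SimpleGraph V) :
    permPoly G = (charMat G).permanent := by
  classical
  unfold permPoly
  congr 1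
  ext1 i j
  by_cases h : i = j
  · subst h
    simp [charMat, charmatrix_apply_eq]
  · rw [charmatrix_apply_ne _ _ _ h]
    by_cases h' : G.Adj i j <;> simp [charMat, h, h']

/-- The vertices of the coalescence with a rooted join. -/
def coalescenceVertEquiv (V W : Type*) (k : ℕ) :
    V ⊕ Fin k × W ≃ CoalescenceVert V (none : Option (Fin k × W)) :=
  Equiv.sumCongr (Equiv.refl V)
    { toFun := fun p => ⟨some p, by simp⟩
      invFun := fun p => p.1.get (Option.isSome_iff_ne_none.2 p.2)
      left_inv := fun p => by simp
      right_inv := fun p => by simp }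

theorem charMat_coalescence {V W : Type*} [DecidableEq V] [DecidableEq W] (G : SimpleGraph V)
    (r : V) (T : SimpleGraph W) (u : W) (k : ℕ) :
    (charMat (coalescence G r (rootedJoin T u k) none)).submatrix (coalescenceVertEquiv V W k)
      (coalescenceVertEquiv V W k) = attachCopies (charMat G) r (charMat T) u (-1) k := by
  have hl (v w : V) : coalescenceLeft V (none : Option (Fin k × W)) v = Sum.inl w ↔ v = w :=
    Sum.inl_injective.eq_iff
  have hl' (v : V) (p) : coalescenceLeft V (none : Option (Fin k × W)) v ≠ Sum.inr p :=
    Sum.inl_ne_inr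
  have hr (w : Option (Fin k × W)) (v : V) :
      coalescenceRight r (none : Option (Fin k × W)) w = Sum.inl v ↔ w = none ∧ v = r := by
    rcases w with _ | w <;> simp [coalescenceRight, eq_comm]
  have hr' (w : Option (Fin k × W)) (p) :
      coalescenceRight r (none : Option (Fin k × W)) w = Sum.inr p ↔ w = p.1 := by
    obtain ⟨p, hp⟩ := p
    rcases w with _ | w <;> simp [coalescenceRight, hp.symm]
  have h₁ (p : Fin k × W) : (rootedJoin T u k).Adj none (some p) ↔ p.2 = u := Iff.rfl
  have h₂ (p : Fin k × W) : (rootedJoin T u k).Adj (some p) none ↔ p.2 = u := Iff.rfl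
  have h₃ (p q : Fin k × W) :
      (rootedJoin T u k).Adj (some p) (some q) ↔ p.1 = q.1 ∧ T.Adj p.2 q.2 := Iff.rfl
  ext1 (a | ⟨i, a⟩) (b | ⟨j, b⟩)
  · by_cases hab : a = b <;> by_cases hadj : G.Adj a b <;>
      simp [charMat, attachCopies, coalescence, coalescenceVertEquiv, SimpleGraph.map_adj, hl,
        hr, hab, hadj]
  · simp [charMat, attachCopies, coalescence, coalescenceVertEquiv, SimpleGraph.map_adj, hl,
      hl', hr, hr', h₁, and_comm, eq_comm]
  · simp [charMat, attachCopies, coalescence, coalescenceVertEquiv, SimpleGraph.map_adj, hl,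
      hl', hr, hr', h₂, and_comm, eq_comm]
  · by_cases hij : i = j <;> by_cases hab : a = b <;> by_cases hadj : T.Adj a b <;>
      simp [charMat, attachCopies, coalescence, coalescenceVertEquiv, SimpleGraph.map_adj,
        hl', hr', h₃, hab, hij, hadj]

/-- The star is itself a single vertex with `l` single vertices attached, so the formulas for
`attachCopies` apply again. -/
theorem permanent_charMat_star (l : ℕ) :
    X * (charMat (completeBipartiteGraph (Fin 1) (Fin l))).permanent =
      X ^ l * (X ^ 2 + (l : ℂ[X])) ∧
    ((charMat (completeBipartiteGraph (Fin 1) (Fin l))).deleteIndex (Sum.inl 0)).permanent =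
      X ^ l := by
  let e : Fin 1 ⊕ Fin l × Fin 1 ≃ Fin 1 ⊕ Fin l :=
    Equiv.sumCongr (Equiv.refl _) (Equiv.prodUnique _ _)
  have h : (charMat (completeBipartiteGraph (Fin 1) (Fin l))).submatrix e e =
      attachCopies (of fun _ _ => X) 0 (of fun _ _ => X) 0 (-1) l := by
    ext1 (i | ⟨i, j⟩) (i' | ⟨i', j'⟩) <;>
      simp [charMat, attachCopies, e, eq_iff_true_of_subsingleton]
  have hd : ((of fun _ _ => X : Matrix (Fin 1) (Fin 1) ℂ[X]).deleteIndex 0).permanent = 1 := by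
    simp [deleteIndex]
  constructor
  · rw [← permanent_submatrix_equiv e, h]
    have := permanent_attachCopies (of fun _ _ => X : Matrix (Fin 1) (Fin 1) ℂ[X]) 0
      (of fun _ _ => X : Matrix (Fin 1) (Fin 1) ℂ[X]) 0 (-1) l
    rw [hd] at this
    simp only [permanent_unique, of_apply] at this
    rw [this]
    ring
  · have := permanent_deleteIndex_attachCopies (of fun _ _ => X : Matrix (Fin 1) (Fin 1) ℂ[X]) 0
      (of fun _ _ => X : Matrix (Fin 1) (Fin 1) ℂ[X]) 0 (-1) l
    rw [← h, submatrix_deleteIndex, permanent_submatrix_equiv, hd] at this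
    simpa [e] using this

theorem charMat_K₂₃_submatrix :
    (charMat (completeBipartiteGraph (Fin 2) (Fin 3))).submatrix
      (finSumFinEquiv (m := 2) (n := 3)).symm (finSumFinEquiv (m := 2) (n := 3)).symm =
      !![X, 0, -1, -1, -1; 0, X, -1, -1, -1; -1, -1, X, 0, 0; -1, -1, 0, X, 0;
        -1, -1, 0, 0, X] := by
  ext1 i j
  fin_cases i <;> fin_cases j <;>
    simp [charMat, finSumFinEquiv, Fin.addCases, Fin.castLT, Fin.subNat]

theorem permanent_charMat_K₂₃ :
    (charMat (completeBipartiteGraph (Fin 2) (Fin 3))).permanent = X ^ 5 + 6 * X ^ 3 + 12 * X := by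
  rw [← permanent_submatrix_equiv finSumFinEquiv.symm, charMat_K₂₃_submatrix]
  simp [permanent_succ_column_zero (n := 4), permanent_succ_column_zero (n := 3),
    permanent_fin_three, Fin.sum_univ_succ, Fin.succAbove]
  ring

theorem permanent_deleteIndex_charMat_K₂₃ (i : Fin 2) :
    ((charMat (completeBipartiteGraph (Fin 2) (Fin 3))).deleteIndex (Sum.inl i)).permanent =
      X ^ 4 + 3 * X ^ 2 := by
  have h : ((charMat (completeBipartiteGraph (Fin 2) (Fin 3))).deleteIndex (Sum.inl i)).submatrix
      (finSumFinEquiv (m := 2) (n := 3)).symm (finSumFinEquiv (m := 2) (n := 3)).symm =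
      deleteIndex !![X, 0, -1, -1, -1; 0, X, -1, -1, -1; -1, -1, X, 0, 0; -1, -1, 0, X, 0;
        -1, -1, 0, 0, X] (finSumFinEquiv (n := 3) (Sum.inl i)) := by
    rw [← charMat_K₂₃_submatrix, submatrix_deleteIndex, Equiv.symm_apply_apply]
  have h₀ : deleteIndex !![X, 0, -1, -1, -1; 0, X, -1, -1, -1; -1, -1, X, 0, 0; -1, -1, 0, X, 0;
        -1, -1, 0, 0, X] (0 : Fin 5) = !![(1 : ℂ[X]), 0, -1, -1, -1; 0, X, -1, -1, -1;
        0, -1, X, 0, 0; 0, -1, 0, X, 0; 0, -1, 0, 0, X] := by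
    ext1 i j
    fin_cases i <;> fin_cases j <;> simp [deleteIndex]
  have h₁ : deleteIndex !![X, 0, -1, -1, -1; 0, X, -1, -1, -1; -1, -1, X, 0, 0; -1, -1, 0, X, 0;
        -1, -1, 0, 0, X] (1 : Fin 5) = !![(X : ℂ[X]), 0, -1, -1, -1; 0, 1, -1, -1, -1;
        -1, 0, X, 0, 0; -1, 0, 0, X, 0; -1, 0, 0, 0, X] := by
    ext1 i j
    fin_cases i <;> fin_cases j <;> simp [deleteIndex]
  rw [← permanent_submatrix_equiv finSumFinEquiv.symm, h]
  fin_cases i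
  · refine (congrArg permanent h₀).trans ?_
    simp [permanent_succ_column_zero (n := 4), permanent_succ_column_zero (n := 3),
      permanent_fin_three, Fin.sum_univ_succ, Fin.succAbove]
    ring
  · refine (congrArg permanent h₁).trans ?_
    simp [permanent_succ_column_zero (n := 4), permanent_succ_column_zero (n := 3),
      permanent_fin_three, Fin.sum_univ_succ, Fin.succAbove]
    ring

/-- The factor of the permanental polynomial of the coalescence of `K_{2,3}` with the starlike tree
that is not a factor of a power of the polynomial of the star. -/
noncomputable def mainFactor (l k : ℕ) : ℂ[X] :=
  (X ^ 2 + (l : ℂ[X])) * (X ^ 4 + 6 * X ^ 2 + 12) + (k : ℂ[X]) * (X ^ 4 + 3 * X ^ 2)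

theorem permPoly_mul_star (l k : ℕ) (i : Fin 2) :
    (charMat (completeBipartiteGraph (Fin 1) (Fin l))).permanent *
      permPoly (coalescence (completeBipartiteGraph (Fin 2) (Fin 3)) (Sum.inl i)
        (starlikeTree l k) none) =
    (charMat (completeBipartiteGraph (Fin 1) (Fin l))).permanent ^ k *
      (X ^ l * mainFactor l k) := by
  obtain ⟨h₁, h₂⟩ := permanent_charMat_star l
  rw [permPoly_eq, starlikeTree, ← permanent_submatrix_equiv (coalescenceVertEquiv _ _ k),
    charMat_coalescence, permanent_attachCopies, permanent_charMat_K₂₃,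
    permanent_deleteIndex_charMat_K₂₃, h₂, mainFactor]
  linear_combination (charMat (completeBipartiteGraph (Fin 1) (Fin l))).permanent ^ k *
    (X ^ 4 + 6 * X ^ 2 + 12) * h₁

theorem permPoly_zero (l : ℕ) (i : Fin 2) :
    permPoly (coalescence (completeBipartiteGraph (Fin 2) (Fin 3)) (Sum.inl i)
        (starlikeTree l 0) none) = X ^ 5 + 6 * X ^ 3 + 12 * X := by
  rw [permPoly_eq, starlikeTree, ← permanent_submatrix_equiv (coalescenceVertEquiv _ _ 0),
    charMat_coalescence, ← permanent_charMat_K₂₃,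
    ← permanent_submatrix_equiv (Equiv.sumEmpty (Fin 2 ⊕ Fin 3) (Fin 0 × (Fin 1 ⊕ Fin l))).symm]
  rfl

/-! ### Sufficiency: real-rootedness from sign changes -/

/-- A monic real cubic that is nonpositive at `c`, nonnegative at `0 > c` and at some point below
`c` has only real roots. -/
theorem im_eq_zero_of_cubic {a b d c y : ℝ} (hc : c ≤ 0) (hy : y < c)
    (h₀ : 0 ≤ d) (h₁ : c ^ 3 + a * c ^ 2 + b * c + d ≤ 0)
    (h₂ : 0 ≤ y ^ 3 + a * y ^ 2 + b * y + d) {w : ℂ}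
    (hw : w ^ 3 + a * w ^ 2 + b * w + d = 0) : w.im = 0 := by
  obtain ⟨ρ, ⟨hρ, -⟩, hρ0⟩ : ∃ ρ ∈ Set.Icc c 0, ρ ^ 3 + a * ρ ^ 2 + b * ρ + d = 0 := by
    have hf : ContinuousOn (fun ρ : ℝ => ρ ^ 3 + a * ρ ^ 2 + b * ρ + d) (Set.Icc c 0) := by
      fun_prop
    exact intermediate_value_Icc hc hf ⟨h₁, by simpa using h₀⟩
  have hyρ : y - ρ < 0 := by linarith
  -- The quadratic cofactor of `w - ρ` is nonpositive at `y`; a monic real quadratic with nonreal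
  -- roots would be positive there.
  have hq : y ^ 2 + (a + ρ) * y + (b + (a + ρ) * ρ) ≤ 0 := by
    by_contra! hq
    nlinarith [mul_neg_of_neg_of_pos hyρ hq]
  have hfac : (w - ρ) * (w ^ 2 + (a + ρ) * w + (b + (a + ρ) * ρ)) = 0 := by
    have hρ0' : (ρ : ℂ) ^ 3 + a * ρ ^ 2 + b * ρ + d = 0 := by exact_mod_cast hρ0
    linear_combination hw - hρ0'
  rcases mul_eq_zero.1 hfac with h | h
  · rw [sub_eq_zero.1 h, Complex.ofReal_im]
  · by_contra him
    have hi := congrArg Complex.im h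
    have hr := congrArg Complex.re h
    simp [pow_two] at hi hr
    have h2 : 2 * w.re + (a + ρ) = 0 := by
      apply mul_left_cancel₀ him
      linarith
    have : 0 < w.im ^ 2 := by positivity
    nlinarith [sq_nonneg (y - w.re)]

theorem re_eq_zero_of_sq {z : ℂ} (h₁ : (z ^ 2).im = 0) (h₂ : (z ^ 2).re ≤ 0) : z.re = 0 := by
  simp [pow_two] at h₁ h₂
  by_contra h
  have h3 : z.im = 0 := by
    apply mul_left_cancel₀ h
    linarith
  have : 0 < z.re ^ 2 := by positivity
  rw [h3] at h₂
  nlinarith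

theorem eval_mainFactor (l k : ℕ) (z : ℂ) :
    (mainFactor l k).eval z = (z ^ 2) ^ 3 + ((6 + l + k : ℝ) : ℂ) * (z ^ 2) ^ 2 +
      ((12 + 6 * l + 3 * k : ℝ) : ℂ) * z ^ 2 + ((12 * l : ℝ) : ℂ) := by
  simp [mainFactor]
  ring

theorem re_eq_zero_of_eval_mainFactor {l k : ℕ} (hk : 1 ≤ k)
    (h : (l ≤ 3 ∧ 4 ≤ l + k) ∨ (4 ≤ l ∧ 2 * (l : ℤ) - 4 ≤ (k : ℤ))) {z : ℂ}
    (hz : (mainFactor l k).eval z = 0) : z.re = 0 := by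
  rw [eval_mainFactor] at hz
  have him : (z ^ 2).im = 0 := by
    rcases h with ⟨h₁, h₂⟩ | ⟨h₁, h₂⟩
    · have h₁' : (l : ℝ) ≤ 3 := by exact_mod_cast h₁
      have h₂' : (4 : ℝ) ≤ l + k := by exact_mod_cast h₂
      -- The cubic is `3(l - 3)` at `-3` and `4(l + k - 4)` at `-4`.
      refine im_eq_zero_of_cubic (c := -3) (y := -4) (by norm_num) (by norm_num) (by positivity)
        ?_ ?_ hz <;> linarith
    · have h₁' : (4 : ℝ) ≤ l := by exact_mod_cast h₁
      have h₂' : 2 * (l : ℝ) - 4 ≤ k := by exact_mod_cast h₂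
      -- The cubic is `2(2l - 4 - k)` at `-2` and `3(l - 3)` at `-3`.
      refine im_eq_zero_of_cubic (c := -2) (y := -3) (by norm_num) (by norm_num) (by positivity)
        ?_ ?_ hz <;> linarith
  refine re_eq_zero_of_sq him ?_
  obtain ⟨x, hx⟩ : ∃ x : ℝ, z ^ 2 = x := ⟨(z ^ 2).re, by apply Complex.ext <;> simp [him]⟩
  rw [hx] at hz ⊢
  by_contra! hpos
  rw [Complex.ofReal_re] at hpos
  have hz' : x ^ 3 + (6 + l + k : ℝ) * x ^ 2 + (12 + 6 * l + 3 * k : ℝ) * x + 12 * l = 0 := by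
    exact_mod_cast hz
  have : 0 < x ^ 3 + (6 + l + k : ℝ) * x ^ 2 + (12 + 6 * l + 3 * k : ℝ) * x + 12 * l := by
    positivity
  linarith

/-! ### Necessity: the position of the roots relative to -3 -/

theorem exists_roots_cubic (a b d : ℂ) : ∃ x y z : ℂ,
    ∀ w, w ^ 3 + a * w ^ 2 + b * w + d = (w - x) * (w - y) * (w - z) := by
  let P : Cubic ℂ := ⟨1, a, b, d⟩
  obtain ⟨x, y, z, h⟩ := (Cubic.splits_iff_roots_eq_three (P := P) (φ := RingHom.id ℂ)
    one_ne_zero).1 (IsAlgClosed.splits _)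
  refine ⟨x, y, z, fun w => ?_⟩
  have := congrArg (Polynomial.eval w) (Cubic.eq_prod_three_roots (φ := RingHom.id ℂ) (P := P)
    one_ne_zero h)
  simpa [P, Cubic.toPoly, Cubic.map] using this

/-- If all roots of `mainFactor l k` are purely imaginary, then it is determined by three
nonpositive reals. -/
theorem exists_real_roots {l k : ℕ} (h : ∀ z, (mainFactor l k).eval z = 0 → z.re = 0) :
    ∃ x y z : ℝ, x ≤ 0 ∧ y ≤ 0 ∧ z ≤ 0 ∧ ∀ w : ℝ,
      (w ^ 2 + 6 * w + 12) * (w + l) + k * w * (w + 3) = (w - x) * (w - y) * (w - z) := by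
  obtain ⟨x, y, z, hw⟩ := exists_roots_cubic ((6 + l + k : ℝ) : ℂ) ((12 + 6 * l + 3 * k : ℝ) : ℂ)
    ((12 * l : ℝ) : ℂ)
  -- A root `u` of the cubic is the square of a root `v` of `mainFactor`, so `u = -(im v)²`.
  have key (u : ℂ) (hu : (u - x) * (u - y) * (u - z) = 0) : ∃ t : ℝ, t ≤ 0 ∧ u = t := by
    obtain ⟨v, rfl⟩ := IsAlgClosed.exists_pow_nat_eq u two_pos
    have hv := h v (by rw [eval_mainFactor, hw, hu])
    refine ⟨-v.im ^ 2, by nlinarith [sq_nonneg v.im], ?_⟩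
    apply Complex.ext <;> simp [pow_two, hv]
  obtain ⟨x, hx, rfl⟩ := key x (by ring)
  obtain ⟨y, hy, rfl⟩ := key y (by ring)
  obtain ⟨z, hz, rfl⟩ := key z (by ring)
  refine ⟨x, y, z, hx, hy, hz, fun w => ?_⟩
  have := hw w
  norm_cast at this
  rw [← this]
  push_cast
  ring

theorem cond_of_real_roots {l k : ℕ} (hk : 1 ≤ k) {x y z : ℝ} (hx : x ≤ 0) (hy : y ≤ 0)
    (hz : z ≤ 0) (h : ∀ w : ℝ,
      (w ^ 2 + 6 * w + 12) * (w + l) + k * w * (w + 3) = (w - x) * (w - y) * (w - z)) :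
    (l ≤ 3 ∧ 4 ≤ l + k) ∨ (4 ≤ l ∧ 2 * (l : ℤ) - 4 ≤ (k : ℤ)) := by
  have hk' : (1 : ℝ) ≤ k := by exact_mod_cast hk
  -- Both sides are the derivative of the cubic at `-3`.
  have e₂ : (x + 3) * (y + 3) + (x + 3) * (z + 3) + (y + 3) * (z + 3) = 3 - 3 * k := by
    linarith [h 0, h 1, h (-1), h 2]
  have hroot (w : ℝ) (hw : w = x ∨ w = y ∨ w = z) :
      (w ^ 2 + 6 * w + 12) * (w + l) + k * w * (w + 3) = 0 := by
    rw [h]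
    rcases hw with rfl | rfl | rfl <;> ring
  rcases le_or_gt l 3 with hl | hl
  · refine Or.inl ⟨hl, ?_⟩
    by_contra! hlk
    -- For `l + k ≤ 3` the cubic is negative on `w ≤ -3`; only finitely many pairs `(l, k)` occur.
    have hneg (w : ℝ) (hw : w = x ∨ w = y ∨ w = z) : 0 < w + 3 := by
      by_contra! hw3
      have hw0 := hroot w hw
      obtain ⟨s, rfl⟩ : ∃ s, w = -3 - s := ⟨-3 - w, by ring⟩
      have hs : 0 ≤ s := by linarith
      have h3 : (l : ℝ) + k ≤ 3 := by exact_mod_cast (by omega : l + k ≤ 3)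
      have : l ≤ 2 := by omega
      have hk3 : k ≤ 3 := by omega
      interval_cases l <;> interval_cases k <;> first | omega | skip
      all_goals norm_num at hw0
      all_goals nlinarith [sq_nonneg (s - 1), mul_nonneg hs (sq_nonneg (s - 1)),
        mul_nonneg hs (sq_nonneg (s - 3 / 2)), pow_nonneg hs 3, sq_nonneg (s - 3 / 2)]
    have := hneg x (by simp)
    have := hneg y (by simp)
    have := hneg z (by simp)
    have : 0 < (x + 3) * (y + 3) + (x + 3) * (z + 3) + (y + 3) * (z + 3) := by positivity
    linarith
  · refine Or.inr ⟨hl, ?_⟩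
    by_contra! hlk
    have hl' : (4 : ℝ) ≤ l := by exact_mod_cast hl
    have hlk' : (k : ℝ) ≤ 2 * l - 5 := by
      have : (k : ℤ) ≤ 2 * l - 5 := by omega
      exact_mod_cast this
    -- For `k ≤ 2l - 5` the cubic is positive on `[-3, 0]`.
    have hneg (w : ℝ) (hw0 : w ≤ 0) (hw : w = x ∨ w = y ∨ w = z) : w + 3 < 0 := by
      by_contra! hw3
      have h0 := hroot w hw
      obtain ⟨t, rfl⟩ : ∃ t, w = t - 2 := ⟨w + 2, by ring⟩
      obtain ⟨m, hm⟩ : ∃ m : ℝ, (l : ℝ) = m + 2 := ⟨l - 2, by ring⟩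
      rw [hm] at h0 hlk' hl'
      have ht₁ : 0 ≤ 1 + t := by linarith
      have ht₂ : 0 ≤ 2 - t := by linarith
      have h₁ : (k : ℝ) * ((2 - t) * (1 + t)) ≤ (2 * m - 1) * ((2 - t) * (1 + t)) :=
        mul_le_mul_of_nonneg_right (by linarith) (mul_nonneg ht₂ ht₁)
      have h₂ : 0 ≤ (m - 2) * t ^ 2 := mul_nonneg (by linarith) (sq_nonneg t)
      -- With `k` replaced by `2m - 1` the cubic is `3(m - 2)t² + (1 + t)t² + (6t² + 5t + 2)`, and
      -- `24(6t² + 5t + 2) = (12t + 5)² + 23`.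
      nlinarith [mul_nonneg ht₁ (sq_nonneg t), sq_nonneg (12 * t + 5)]
    nlinarith [mul_pos_of_neg_of_neg (hneg x hx (by simp)) (hneg y hy (by simp)),
      mul_pos_of_neg_of_neg (hneg x hx (by simp)) (hneg z hz (by simp)),
      mul_pos_of_neg_of_neg (hneg y hy (by simp)) (hneg z hz (by simp))]

/-! ### Reduction of the spectrum to the main factor -/

theorem star_ne_zero (l : ℕ) :
    (charMat (completeBipartiteGraph (Fin 1) (Fin l))).permanent ≠ 0 := by
  intro h
  have := congrArg (eval 1) (permanent_charMat_star l).1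
  rw [h] at this
  simp at this
  norm_cast at this
  omega

theorem mainFactor_ne_zero (l k : ℕ) : mainFactor l k ≠ 0 := by
  intro h
  have := congrArg (eval 1) h
  simp [mainFactor] at this
  norm_cast at this
  omega

theorem permPoly_succ (l k : ℕ) (i : Fin 2) :
    permPoly (coalescence (completeBipartiteGraph (Fin 2) (Fin 3)) (Sum.inl i)
        (starlikeTree l (k + 1)) none) =
    (charMat (completeBipartiteGraph (Fin 1) (Fin l))).permanent ^ k *
      (X ^ l * mainFactor l (k + 1)) := by
  apply mul_left_cancel₀ (star_ne_zero l)
  rw [permPoly_mul_star]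
  ring

theorem re_eq_zero_of_eval_star {l : ℕ} {z : ℂ}
    (hz : (charMat (completeBipartiteGraph (Fin 1) (Fin l))).permanent.eval z = 0) :
    z.re = 0 := by
  have := congrArg (eval z) (permanent_charMat_star l).1
  simp only [eval_mul, hz, mul_zero, eval_pow, eval_X, eval_add, eval_natCast] at this
  rcases mul_eq_zero.1 this.symm with h | h
  · simp [eq_zero_of_pow_eq_zero h]
  · have h' : z ^ 2 = ((-l : ℝ) : ℂ) := by
      push_cast
      linear_combination h
    apply re_eq_zero_of_sq
    · rw [h', Complex.ofReal_im]
    · rw [h', Complex.ofReal_re]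
      simp

theorem not_hasPurelyImaginaryPerSpectrum_zero (l : ℕ) (i : Fin 2) :
    ¬ HasPurelyImaginaryPerSpectrum (coalescence (completeBipartiteGraph (Fin 2) (Fin 3))
      (Sum.inl i) (starlikeTree l 0) none) := by
  intro h
  -- `w² + 6w + 12 = (w + 3)² + 3` vanishes at `w = -3 + s`, which is not real.
  obtain ⟨s, hs⟩ := IsAlgClosed.exists_pow_nat_eq (-3 : ℂ) two_pos
  obtain ⟨z, hz⟩ := IsAlgClosed.exists_pow_nat_eq (-3 + s) two_pos
  have hz0 : z.re = 0 := by
    apply h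
    rw [perSpectrum, permPoly_zero, mem_roots']
    refine ⟨fun h => ?_, ?_⟩
    · have := congrArg (eval 1) h
      norm_num at this
    · simp only [IsRoot, eval_add, eval_mul, eval_pow, eval_X, eval_ofNat]
      linear_combination z * (z ^ 2 + 3 + s) * hz + z * hs
  have him := congrArg Complex.im hz
  have hs' := congrArg Complex.re hs
  simp [pow_two, hz0] at him hs'
  rw [← him] at hs'
  nlinarith [sq_nonneg s.re]

theorem hasPurelyImaginaryPerSpectrum_succ_iff (l k : ℕ) (i : Fin 2) :
    HasPurelyImaginaryPerSpectrum (coalescence (completeBipartiteGraph (Fin 2) (Fin 3))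
      (Sum.inl i) (starlikeTree l (k + 1)) none) ↔
    ∀ z, (mainFactor l (k + 1)).eval z = 0 → z.re = 0 := by
  have h0 : (charMat (completeBipartiteGraph (Fin 1) (Fin l))).permanent ^ k *
      (X ^ l * mainFactor l (k + 1)) ≠ 0 :=
    mul_ne_zero (pow_ne_zero _ (star_ne_zero l))
      (mul_ne_zero (pow_ne_zero _ X_ne_zero) (mainFactor_ne_zero _ _))
  simp only [HasPurelyImaginaryPerSpectrum, perSpectrum, permPoly_succ, mem_roots h0, IsRoot,
    eval_mul, eval_pow, eval_X]
  refine ⟨fun h z hz => h z (by rw [hz, mul_zero, mul_zero]), fun h z hz => ?_⟩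
  rcases mul_eq_zero.1 hz with hz | hz
  · exact re_eq_zero_of_eval_star (eq_zero_of_pow_eq_zero hz)
  rcases mul_eq_zero.1 hz with hz | hz
  · simp [eq_zero_of_pow_eq_zero hz]
  · exact h z hz

theorem degree_completeBipartiteGraph_inr (α β : Type*) (b : β)
    [Fintype ((completeBipartiteGraph α β).neighborSet (Sum.inr b))] :
    (completeBipartiteGraph α β).degree (Sum.inr b) = Nat.card α := by
  have h : (completeBipartiteGraph α β).neighborSet (Sum.inr b) = Set.range Sum.inl := by
    ext (a | a) <;> simp
  rw [← SimpleGraph.card_neighborSet_eq_degree, ← Nat.card_eq_fintype_card, h,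
    Nat.card_range_of_injective Sum.inl_injective]

end PerSpectrum

open PerSpectrum
theorem theorem3p2 (l k : ℕ) (r₁ : Fin 2 ⊕ Fin 3)
    [Fintype ((completeBipartiteGraph (Fin 2) (Fin 3)).neighborSet r₁)]
    (hr₁ : (completeBipartiteGraph (Fin 2) (Fin 3)).degree r₁ = 3) :
    PerSpectrum.HasPurelyImaginaryPerSpectrum
        (PerSpectrum.coalescence (completeBipartiteGraph (Fin 2) (Fin 3)) r₁
          (PerSpectrum.starlikeTree l k) none) ↔
      (l ≤ 3 ∧ 4 ≤ l + k) ∨ (4 ≤ l ∧ 2 * (l : ℤ) - 4 ≤ (k : ℤ)) := by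
  rcases r₁ with i | j
  · rcases k with _ | k
    · refine iff_of_false (not_hasPurelyImaginaryPerSpectrum_zero l i) ?_
      omega
    · rw [hasPurelyImaginaryPerSpectrum_succ_iff]
      refine ⟨fun h => ?_, fun h z hz => re_eq_zero_of_eval_mainFactor (by omega) h hz⟩
      obtain ⟨x, y, z, hx, hy, hz, hw⟩ := exists_real_roots h
      exact cond_of_real_roots (by omega) hx hy hz hw
  -- Vertices of the three-element side have degree `2`.
  · rw [degree_completeBipartiteGraph_inr] at hr₁
    simp at hr₁
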